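/- Let $f\in C([0,1]\times\mathbb R^2,\mathbb R)$ and consider the periodic problem $$-x''=f(t,x,x')\quad(t\in[0,1]),\qquad x(0)=x(1),\quad x'(0)=x'(1).\tag{P}$$ Let $\alpha,\beta\in C^2[0,1]$ be a lower and an upper solution of (P), that is, $-\alpha''(t)\le f(t,\alpha(t),\alpha'(t))$ and $-\beta''(t)\ge f(t,\beta(t),\beta'(t))$ for $t\in[0,1]$, $\alpha(0)=\alpha(1)$, $\beta(0)=\beta(1)$. Suppose that $\alpha(t)\le\beta(t)$ for $t\in[0,1]$, that $\alpha'(0)-\alpha'(1)\ge 0$ and $\beta'(1)-\beta'(0)\ge 0$, and that there are constants $\mu>0$ and $\ell>0$ such that $$|f(t,x_1,y_1)-f(t,x_2,y_2)|\le \ell|x_1-x_2|+\ell|y_1-y_2|$$ whenever both points $(t,x_i,y_i)$, $i=1,2$, lie in $G_\alpha$ or both lie in $G_\beta$, where $G_\gamma=\{(t,x,y): t\in[0,1],\ |x-\gamma(t)|\le\mu,\ |y-\gamma'(t)|\le\mu\}$. Let $\Gamma=\{(t,x): t\in[0,1],\ \alpha(t)\le x\le\beta(t)\}$, and suppose that $f=f_1+f_2$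 on $[0,1]\times\mathbb R^2$ with real-valued functions $f_1,f_2$, and that there are a function $c(\cdot)\in C[0,1]$ and a constant $c<1$ with $c(t)(\beta(t)-\alpha(t))\le c$ for all $t\in[0,1]$, such that one of the following holds: 1. $\limsup_{|y|\to\infty}\dfrac{y f_1(t,x,y)}{|y|^3}\le c(t)$ uniformly on $\Gamma$ (for every $\varepsilon>0$ there is $Y>0$ such that $y f_1(t,x,y)/|y|^3\le c(t)+\varepsilon$ for all $(t,x)\in\Gamma$ and $|y|\ge Y$), and $f_2(t,x,y)$ is nonincreasing in $y$ for each $(t,x)\in\Gamma$; 2. $\liminf_{|y|\to\infty}\dfrac{y f_1(t,x,y)}{|y|^3}\ge -c(t)$ uniformly on $\Gamma$ (for every $\varepsilon>0$ there is $Y>0$ such that $y f_1(t,x,y)/|y|^3\ge -c(t)-\varepsilon$ for all $(t,x)\in\Gamma$ and $|y|\ge Y$), and $f_2(t,x,y)$ is nondecreasing in $y$ for each $(t,x)\in\Gamma$. Then (P) has a solution $x\in C^2[0,1]$ satisfying $\alpha(t)\le x(t)\le\beta(t)$ for all $t\in[0,1]$. -/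

import Mathlib

open Set

namespace PeriodicBVP

/-- First derivative on `[0,1]` (one-sided at the endpoints). -/
noncomputable def d1 (x : ℝ → ℝ) (t : ℝ) : ℝ := derivWithin x (Icc 0 1) t

/-- Second derivative on `[0,1]` (one-sided at the endpoints). -/
noncomputable def d2 (x : ℝ → ℝ) (t : ℝ) : ℝ := derivWithin (d1 x) (Icc 0 1) t

/-- `α ∈ C²[0,1]` is a lower solution of `-x'' = f(t,x,x')`, `x(0) = x(1)`, `x'(0) = x'(1)`. -/
structure IsLowerSolution (f : ℝ → ℝ → ℝ → ℝ) (α : ℝ → ℝ) : Prop where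
  contDiffOn : ContDiffOn ℝ 2 α (Icc 0 1)
  le : ∀ t ∈ Icc (0 : ℝ) 1, -d2 α t ≤ f t (α t) (d1 α t)
  bdry : α 0 = α 1

/-- `β ∈ C²[0,1]` is an upper solution of `-x'' = f(t,x,x')`, `x(0) = x(1)`, `x'(0) = x'(1)`. -/
structure IsUpperSolution (f : ℝ → ℝ → ℝ → ℝ) (β : ℝ → ℝ) : Prop where
  contDiffOn : ContDiffOn ℝ 2 β (Icc 0 1)
  ge : ∀ t ∈ Icc (0 : ℝ) 1, f t (β t) (d1 β t) ≤ -d2 β t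
  bdry : β 0 = β 1

/-- `x ∈ C²[0,1]` solves `-x'' = f(t,x,x')` on `[0,1]`, `x(0) = x(1)`, `x'(0) = x'(1)`. -/
structure IsSolution (f : ℝ → ℝ → ℝ → ℝ) (x : ℝ → ℝ) : Prop where
  contDiffOn : ContDiffOn ℝ 2 x (Icc 0 1)
  eq : ∀ t ∈ Icc (0 : ℝ) 1, -d2 x t = f t (x t) (d1 x t)
  bdry : x 0 = x 1
  bdry' : d1 x 0 = d1 x 1

/-- The tube of points `(t, x, y)` with `t ∈ [0,1]`, `|x - γ(t)| ≤ μ`, `|y - γ'(t)| ≤ μ`. -/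
def tube (γ : ℝ → ℝ) (μ : ℝ) : Set (ℝ × ℝ × ℝ) :=
  {p | p.1 ∈ Icc (0 : ℝ) 1 ∧ p.2.1 ∈ Icc (γ p.1 - μ) (γ p.1 + μ) ∧
    p.2.2 ∈ Icc (d1 γ p.1 - μ) (d1 γ p.1 + μ)}

/-- `f` is Lipschitz in `(x, y)` near the curves `(t, α, α')` and `(t, β, β')`. -/
def LipschitzNear (f : ℝ → ℝ → ℝ → ℝ) (α β : ℝ → ℝ) : Prop :=
  ∃ μ > 0, ∃ l > 0, ∀ t x₁ y₁ x₂ y₂ : ℝ,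
    ((t, x₁, y₁) ∈ tube α μ ∧ (t, x₂, y₂) ∈ tube α μ) ∨
      ((t, x₁, y₁) ∈ tube β μ ∧ (t, x₂, y₂) ∈ tube β μ) →
    |f t x₁ y₁ - f t x₂ y₂| ≤ l * |x₁ - x₂| + l * |y₁ - y₂|

/-- The region `Γ` between `α` and `β`. -/
def region (α β : ℝ → ℝ) : Set (ℝ × ℝ) :=
  {p | p.1 ∈ Icc (0 : ℝ) 1 ∧ p.2 ∈ Icc (α p.1) (β p.1)}

/-- `limsup_{|y| → ∞} y g(t,x,y) / |y|³ ≤ c(t)`, uniformly for `(t, x) ∈ Γ`. -/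
def UniformLimsupLE (Γ : Set (ℝ × ℝ)) (g : ℝ → ℝ → ℝ → ℝ) (c : ℝ → ℝ) : Prop :=
  ∀ ε > 0, ∃ Y > 0, ∀ t x : ℝ, (t, x) ∈ Γ → ∀ y : ℝ, Y ≤ |y| →
    y * g t x y / |y| ^ 3 ≤ c t + ε

/-- `liminf_{|y| → ∞} y g(t,x,y) / |y|³ ≥ c(t)`, uniformly for `(t, x) ∈ Γ`. -/
def UniformLiminfGE (Γ : Set (ℝ × ℝ)) (g : ℝ → ℝ → ℝ → ℝ) (c : ℝ → ℝ) : Prop :=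
  ∀ ε > 0, ∃ Y > 0, ∀ t x : ℝ, (t, x) ∈ Γ → ∀ y : ℝ, Y ≤ |y| →
    c t - ε ≤ y * g t x y / |y| ^ 3

end PeriodicBVP

namespace PeriodicBVP

/-! In case 1 the bound on `f₁` and the monotonicity of `f₂` give `y f ≤ C|y|³` on the region for
large `|y|` (`exists_oneSidedGrowth`); case 2 gives the same for `-f`. For periodic functions such a
one-sided Nagumo condition already bounds the derivative (`IsPeriodicC2.deriv_le`): if `x'' ≥ -C
x'²` wherever `x' ≥ Y`, then `x' exp(C x)`, once large, stays large up to `t = 1`, hence by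
periodicity on all of `[0,1]`; then `x` increases strictly, contrary to `x(0) = x(1)`. Passing to
`-x` bounds `x'` from below, and time reversal handles case 2.

Truncate `f` in `x` to `[α, β]` and in `x'` to `[-N, N]`, and solve `-u'' + u = g(t, u, u')` with
the resulting bounded `g`. The maximum principle `nonpos_of_deriv₂_pos` puts `u` between `α` and
`β`, and the Nagumo bound gives `|u'| ≤ N`, so the truncation is inactive.

Existence for bounded `g` (`exists_periodic_solution_of_bounded`) comes from Lipschitz approximation
of `g`, monotone iteration for the Lipschitz problem, and Arzelà–Ascoli. -/

/-- `u'`, `u''` are the first two derivatives of `u` on `[0,1]`, and `u`, `u'` take equal values at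
the endpoints. -/
structure IsPeriodicC2 (u u' u'' : ℝ → ℝ) : Prop where
  deriv₁ : ∀ t ∈ Icc (0 : ℝ) 1, HasDerivWithinAt u (u' t) (Icc 0 1) t
  deriv₂ : ∀ t ∈ Icc (0 : ℝ) 1, HasDerivWithinAt u' (u'' t) (Icc 0 1) t
  bdry : u 0 = u 1
  bdry' : u' 0 = u' 1

/-! ### Operations on periodic functions -/

lemma IsPeriodicC2.sub {u u' u'' v v' v'' : ℝ → ℝ} (hu : IsPeriodicC2 u u' u'')
    (hv : IsPeriodicC2 v v' v'') :
    IsPeriodicC2 (fun t => u t - v t) (fun t => u' t - v' t) (fun t => u'' t - v'' t) where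
  deriv₁ t ht := (hu.deriv₁ t ht).sub (hv.deriv₁ t ht)
  deriv₂ t ht := (hu.deriv₂ t ht).sub (hv.deriv₂ t ht)
  bdry := by simp only [hu.bdry, hv.bdry]
  bdry' := by simp only [hu.bdry', hv.bdry']

lemma IsPeriodicC2.neg {u u' u'' : ℝ → ℝ} (hu : IsPeriodicC2 u u' u'') :
    IsPeriodicC2 (fun t => -u t) (fun t => -u' t) (fun t => -u'' t) where
  deriv₁ t ht := (hu.deriv₁ t ht).neg
  deriv₂ t ht := (hu.deriv₂ t ht).neg
  bdry := by simp only [hu.bdry]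
  bdry' := by simp only [hu.bdry']

lemma one_sub_mem_Icc {t : ℝ} (ht : t ∈ Icc (0 : ℝ) 1) : 1 - t ∈ Icc (0 : ℝ) 1 :=
  ⟨by linarith [ht.2], by linarith [ht.1]⟩

lemma hasDerivWithinAt_comp_one_sub {u : ℝ → ℝ} {d t : ℝ}
    (h : HasDerivWithinAt u d (Icc 0 1) (1 - t)) :
    HasDerivWithinAt (fun s => u (1 - s)) (-d) (Icc 0 1) t := by
  have h1 : HasDerivWithinAt (fun s : ℝ => 1 - s) (-1) (Icc 0 1) t := by
    simpa using ((hasDerivAt_id t).const_sub 1).hasDerivWithinAt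
  exact (h.comp t h1 (fun s hs => one_sub_mem_Icc hs)).congr_deriv (by ring)

lemma IsPeriodicC2.reflect {u u' u'' : ℝ → ℝ} (hu : IsPeriodicC2 u u' u'') :
    IsPeriodicC2 (fun t => u (1 - t)) (fun t => -u' (1 - t)) (fun t => u'' (1 - t)) where
  deriv₁ t ht := hasDerivWithinAt_comp_one_sub (hu.deriv₁ _ (one_sub_mem_Icc ht))
  deriv₂ t ht :=
    (hasDerivWithinAt_comp_one_sub (hu.deriv₂ _ (one_sub_mem_Icc ht))).neg.congr_deriv (by ring)
  bdry := by simp [hu.bdry]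
  bdry' := by simp [hu.bdry']

lemma IsPeriodicC2.continuousOn {u u' u'' : ℝ → ℝ} (hu : IsPeriodicC2 u u' u'') :
    ContinuousOn u (Icc 0 1) := fun t ht => (hu.deriv₁ t ht).continuousWithinAt

lemma IsPeriodicC2.continuousOn' {u u' u'' : ℝ → ℝ} (hu : IsPeriodicC2 u u' u'') :
    ContinuousOn u' (Icc 0 1) := fun t ht => (hu.deriv₂ t ht).continuousWithinAt

/-! ### Maximum principle -/

lemma mul_deriv_nonpos_of_isMaxOn {w : ℝ → ℝ} {d t s : ℝ} (hmax : IsMaxOn w (Icc 0 1) t)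
    (hd : HasDerivWithinAt w d (Icc 0 1) t) (ht : t ∈ Icc (0 : ℝ) 1) (hs : s ∈ Icc (0 : ℝ) 1) :
    (s - t) * d ≤ 0 := by
  have h := hmax.localize.hasFDerivWithinAt_nonpos hd.hasFDerivWithinAt
    (sub_mem_posTangentConeAt_of_segment_subset ((convex_Icc (0 : ℝ) 1).segment_subset ht hs))
  simpa using h

/-- A maximum principle for periodic boundary conditions. -/
lemma nonpos_of_deriv₂_pos {w w' w'' : ℝ → ℝ}
    (h₁ : ∀ t ∈ Icc (0 : ℝ) 1, HasDerivWithinAt w (w' t) (Icc 0 1) t)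
    (h₂ : ∀ t ∈ Icc (0 : ℝ) 1, HasDerivWithinAt w' (w'' t) (Icc 0 1) t)
    (hb : w 0 = w 1) (hb' : w' 1 ≤ w' 0)
    (H : ∀ t ∈ Icc (0 : ℝ) 1, 0 < w t → w' t = 0 → 0 < w'' t) :
    ∀ t ∈ Icc (0 : ℝ) 1, w t ≤ 0 := by
  have hcont : ContinuousOn w (Icc 0 1) := fun t ht => (h₁ t ht).continuousWithinAt
  have m0 : (0 : ℝ) ∈ Icc (0 : ℝ) 1 := ⟨le_rfl, zero_le_one⟩
  have m1 : (1 : ℝ) ∈ Icc (0 : ℝ) 1 := ⟨zero_le_one, le_rfl⟩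
  obtain ⟨t₁, ht₁, hmax₁⟩ := isCompact_Icc.exists_isMaxOn ⟨0, m0⟩ hcont
  -- If the maximum sits at an endpoint, both endpoints are maxima, so `w' 0 ≤ 0 ≤ w' 1 ≤ w' 0`.
  -- Taking `t₀ < 1` leaves room to its right.
  obtain ⟨t₀, ht₀, hlt, hmax, hz⟩ : ∃ t₀ ∈ Icc (0 : ℝ) 1, t₀ < 1 ∧ IsMaxOn w (Icc 0 1) t₀ ∧
      w' t₀ = 0 := by
    by_cases hint : 0 < t₁ ∧ t₁ < 1
    · refine ⟨t₁, ht₁, hint.2, hmax₁, ?_⟩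
      have a := mul_deriv_nonpos_of_isMaxOn hmax₁ (h₁ t₁ ht₁) ht₁ m0
      have b := mul_deriv_nonpos_of_isMaxOn hmax₁ (h₁ t₁ ht₁) ht₁ m1
      nlinarith [hint.1, hint.2]
    · have hend : t₁ = 0 ∨ t₁ = 1 := by
        rcases eq_or_lt_of_le ht₁.1 with h | h
        · exact Or.inl h.symm
        · exact Or.inr (le_antisymm ht₁.2 (not_lt.1 fun h' => hint ⟨h, h'⟩))
      have hw : w t₁ = w 0 := by rcases hend with h | h <;> simp [h, hb]
      have M0 : IsMaxOn w (Icc 0 1) 0 := fun s hs => by simpa [hw] using hmax₁ hs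
      have M1 : IsMaxOn w (Icc 0 1) 1 := fun s hs => by simpa [hw, hb] using hmax₁ hs
      have a := mul_deriv_nonpos_of_isMaxOn M0 (h₁ 0 m0) m0 m1
      have b := mul_deriv_nonpos_of_isMaxOn M1 (h₁ 1 m1) m1 m0
      exact ⟨0, m0, zero_lt_one, M0, by linarith⟩
  intro t ht
  by_contra hpos
  have hw0 : 0 < w t₀ := (not_le.1 hpos).trans_le (hmax ht)
  have hdd := H t₀ ht₀ hw0 hz
  -- As `w' t₀ = 0 < w'' t₀`, `w'` is positive just right of `t₀`, and the mean value theorem makes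
  -- `w` exceed its maximum.
  have hs := hasDerivWithinAt_iff_tendsto_slope.1 (h₂ t₀ ht₀)
  have hev := hs.eventually (lt_mem_nhds hdd)
  rw [eventually_nhdsWithin_iff, Metric.eventually_nhds_iff] at hev
  obtain ⟨δ, hδ, hev⟩ := hev
  set b := min 1 (t₀ + δ / 2) with hbdef
  have hb0 : t₀ < b := lt_min hlt (by linarith)
  have hb1 : b ≤ 1 := min_le_left _ _
  have hb2 : b ≤ t₀ + δ / 2 := min_le_right _ _
  have hsub : Icc t₀ b ⊆ Icc 0 1 := Icc_subset_Icc ht₀.1 hb1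
  obtain ⟨s, hs, hslope⟩ := exists_hasDerivAt_eq_slope w w' hb0 (hcont.mono hsub)
    (fun s hs => (h₁ s (hsub ⟨hs.1.le, hs.2.le⟩)).hasDerivAt
      (Icc_mem_nhds (ht₀.1.trans_lt hs.1) (hs.2.trans_le hb1)))
  have hsm : s ∈ Icc (0 : ℝ) 1 := hsub ⟨hs.1.le, hs.2.le⟩
  have hsl := hev (y := s) (by rw [Real.dist_eq, abs_of_pos (sub_pos.2 hs.1)]; linarith [hs.2])
    ⟨hsm, hs.1.ne'⟩
  rw [slope_def_field, hz, sub_zero, div_pos_iff_of_pos_right (sub_pos.2 hs.1), hslope,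
    div_pos_iff_of_pos_right (sub_pos.2 hb0)] at hsl
  have : w b ≤ w t₀ := hmax (hsub ⟨hb0.le, le_rfl⟩)
  linarith

/-! ### Linear periodic problems -/

/-- The first order linear problem `p' = k p - h` has a periodic solution. -/
lemma exists_periodic_first_order {k : ℝ} (hk : k ≠ 0) {h : ℝ → ℝ} (hh : Continuous h) :
    ∃ p : ℝ → ℝ, (∀ t, HasDerivAt p (k * p t - h t) t) ∧ p 0 = p 1 := by
  have hc : Continuous fun s => Real.exp (-(k * s)) * h s := by fun_prop
  set I : ℝ → ℝ := fun t => ∫ s in (0 : ℝ)..t, Real.exp (-(k * s)) * h s with hI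
  have hI' : ∀ t, HasDerivAt I (Real.exp (-(k * t)) * h t) t := fun t =>
    (hc.integral_hasStrictDerivAt 0 t).hasDerivAt
  have hne : Real.exp k - 1 ≠ 0 := by
    rw [sub_ne_zero]; simpa using hk
  -- Variation of constants; the value at `0` is forced by `p 0 = p 1`.
  refine ⟨fun t => Real.exp (k * t) * (Real.exp k * I 1 / (Real.exp k - 1) - I t),
    fun t => ?_, ?_⟩
  · have he : HasDerivAt (fun t => Real.exp (k * t)) (Real.exp (k * t) * k) t := by
      simpa using ((hasDerivAt_id t).const_mul k).exp
    refine (he.mul ((hI' t).const_sub _)).congr_deriv ?_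
    have : Real.exp (k * t) * Real.exp (-(k * t)) = 1 := by rw [← Real.exp_add]; simp
    linear_combination (-h t) * this
  · have : I 0 = 0 := by simp [hI]
    simp only [this, mul_zero, Real.exp_zero, mul_one, sub_zero, one_mul]
    field_simp
    ring

/-- Some maximum point has `k p' ≤ 0`: an interior one has `p' = 0`; otherwise both endpoints are
maxima, and `0` serves for `k > 0`, `1` for `k < 0`. There `k² p ≤ k h`. -/
lemma le_of_periodic_first_order {k H : ℝ} (hk : k ≠ 0) {p h : ℝ → ℝ}
    (hp : ∀ t ∈ Icc (0 : ℝ) 1, HasDerivWithinAt p (k * p t - h t) (Icc 0 1) t) (hb : p 0 = p 1)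
    (hH : ∀ t ∈ Icc (0 : ℝ) 1, |h t| ≤ H) : ∀ t ∈ Icc (0 : ℝ) 1, p t ≤ H / |k| := by
  have m0 : (0 : ℝ) ∈ Icc (0 : ℝ) 1 := ⟨le_rfl, zero_le_one⟩
  have m1 : (1 : ℝ) ∈ Icc (0 : ℝ) 1 := ⟨zero_le_one, le_rfl⟩
  have hcont : ContinuousOn p (Icc 0 1) := fun t ht => (hp t ht).continuousWithinAt
  obtain ⟨t₁, ht₁, hmax₁⟩ := isCompact_Icc.exists_isMaxOn ⟨0, m0⟩ hcont
  have hM : ∀ t ∈ Icc (0 : ℝ) 1, IsMaxOn p (Icc 0 1) t → k * (k * p t - h t) ≤ 0 →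
      p t₁ ≤ H / |k| := by
    intro t ht hm hle
    have h1 : p t₁ = p t := le_antisymm (hm ht₁) (hmax₁ ht)
    rw [h1, le_div_iff₀ (abs_pos.2 hk)]
    have h2 := abs_le.1 (hH t ht)
    rcases lt_or_gt_of_ne hk with hk' | hk'
    · rw [abs_of_neg hk']; nlinarith
    · rw [abs_of_pos hk']; nlinarith
  suffices p t₁ ≤ H / |k| from fun t ht => (hmax₁ ht).trans this
  by_cases hint : 0 < t₁ ∧ t₁ < 1
  · refine hM t₁ ht₁ hmax₁ ?_
    have a := mul_deriv_nonpos_of_isMaxOn hmax₁ (hp t₁ ht₁) ht₁ m0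
    have b := mul_deriv_nonpos_of_isMaxOn hmax₁ (hp t₁ ht₁) ht₁ m1
    have : k * p t₁ - h t₁ = 0 := by nlinarith [hint.1, hint.2]
    simp [this]
  · have hend : t₁ = 0 ∨ t₁ = 1 := by
      rcases eq_or_lt_of_le ht₁.1 with h | h
      · exact Or.inl h.symm
      · exact Or.inr (le_antisymm ht₁.2 (not_lt.1 fun h' => hint ⟨h, h'⟩))
    have hw : p t₁ = p 0 := by rcases hend with h | h <;> simp [h, hb]
    have M0 : IsMaxOn p (Icc 0 1) 0 := fun s hs => by simpa [hw] using hmax₁ hs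
    have M1 : IsMaxOn p (Icc 0 1) 1 := fun s hs => by simpa [hw, hb] using hmax₁ hs
    have a := mul_deriv_nonpos_of_isMaxOn M0 (hp 0 m0) m0 m1
    have b := mul_deriv_nonpos_of_isMaxOn M1 (hp 1 m1) m1 m0
    rcases lt_or_gt_of_ne hk with hk' | hk'
    · exact hM 1 m1 M1 (mul_nonpos_of_nonpos_of_nonneg hk'.le (by linarith))
    · exact hM 0 m0 M0 (mul_nonpos_of_nonneg_of_nonpos hk'.le (by linarith))

lemma abs_le_of_periodic_first_order {k H : ℝ} (hk : k ≠ 0) {p h : ℝ → ℝ}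
    (hp : ∀ t ∈ Icc (0 : ℝ) 1, HasDerivWithinAt p (k * p t - h t) (Icc 0 1) t) (hb : p 0 = p 1)
    (hH : ∀ t ∈ Icc (0 : ℝ) 1, |h t| ≤ H) : ∀ t ∈ Icc (0 : ℝ) 1, |p t| ≤ H / |k| := by
  intro t ht
  have h1 := le_of_periodic_first_order hk hp hb hH t ht
  have h2 := le_of_periodic_first_order (p := fun t => -p t) (h := fun t => -h t) hk
    (fun t ht => (hp t ht).neg.congr_deriv (by ring)) (by simp [hb]) (by simpa using hH) t ht
  exact abs_le.2 ⟨by linarith, h1⟩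

/-- The linear problem `-u'' + k² u = h` has a periodic solution. -/
lemma exists_periodic_linear {k : ℝ} (hk : 0 < k) {h : ℝ → ℝ} (hh : Continuous h) :
    ∃ u u' : ℝ → ℝ, IsPeriodicC2 u u' (fun t => k ^ 2 * u t - h t) ∧
      Continuous u ∧ Continuous u' := by
  -- Factor `u'' - k² u = (D - k)(D + k) u`, with `p = u' + k u`.
  obtain ⟨p, hp, hp01⟩ := exists_periodic_first_order hk.ne' hh
  have hpc : Continuous p := continuous_iff_continuousAt.2 fun t => (hp t).continuousAt
  obtain ⟨u, hu, hu01⟩ := exists_periodic_first_order (neg_ne_zero.2 hk.ne')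
    (h := fun t => -p t) hpc.neg
  have huc : Continuous u := continuous_iff_continuousAt.2 fun t => (hu t).continuousAt
  refine ⟨u, fun t => p t - k * u t, ⟨fun t _ => ?_, fun t _ => ?_, hu01, ?_⟩, huc, by fun_prop⟩
  · exact ((hu t).congr_deriv (by ring)).hasDerivWithinAt
  · exact (((hp t).sub ((hu t).const_mul k)).congr_deriv (by ring)).hasDerivWithinAt
  · simp [hp01, hu01]

/-- The first-order bound is applied to each factor, first to `u' + k u`, then to `u`. The gain `1 /
k` on `u'` makes the later contraction possible. -/
lemma IsPeriodicC2.abs_le_of_linear {k H : ℝ} (hk : 0 < k) {u u' u'' : ℝ → ℝ}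
    (hu : IsPeriodicC2 u u' u'') (hH : ∀ t ∈ Icc (0 : ℝ) 1, |k ^ 2 * u t - u'' t| ≤ H) :
    ∀ t ∈ Icc (0 : ℝ) 1, |u t| ≤ H / k ^ 2 ∧ |u' t| ≤ 2 * H / k := by
  have h1 := abs_le_of_periodic_first_order (p := fun t => u' t + k * u t)
    (h := fun t => k ^ 2 * u t - u'' t) hk.ne'
    (fun t ht => ((hu.deriv₂ t ht).add ((hu.deriv₁ t ht).const_mul k)).congr_deriv (by ring))
    (by simp [hu.bdry, hu.bdry']) hH
  have h2 := abs_le_of_periodic_first_order (p := u) (h := fun t => -(u' t + k * u t))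
    (neg_ne_zero.2 hk.ne') (fun t ht => (hu.deriv₁ t ht).congr_deriv (by ring)) hu.bdry
    (fun t ht => (abs_neg _).trans_le (h1 t ht))
  intro t ht
  have a := h1 t ht
  have b := h2 t ht
  rw [abs_neg, abs_of_pos hk, div_div, ← pow_two] at b
  rw [abs_of_pos hk] at a
  refine ⟨b, ?_⟩
  have e1 : u' t = (u' t + k * u t) - k * u t := by ring
  have e2 : |k * u t| ≤ H / k := by
    rw [abs_mul, abs_of_pos hk]
    calc k * |u t| ≤ k * (H / k ^ 2) := by gcongr
      _ = H / k := by field_simp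
  calc |u' t| = |(u' t + k * u t) - k * u t| := by rw [← e1]
    _ ≤ |u' t + k * u t| + |k * u t| := abs_sub _ _
    _ ≤ H / k + H / k := add_le_add a e2
    _ = 2 * H / k := by ring

lemma IsPeriodicC2.congr {u u' u'' v'' : ℝ → ℝ} (hu : IsPeriodicC2 u u' u'')
    (h : ∀ t ∈ Icc (0 : ℝ) 1, u'' t = v'' t) : IsPeriodicC2 u u' v'' :=
  ⟨hu.deriv₁, fun t ht => h t ht ▸ hu.deriv₂ t ht, hu.bdry, hu.bdry'⟩

lemma IsPeriodicC2.abs_sub_le {u u' u'' : ℝ → ℝ} (hu : IsPeriodicC2 u u' u'') {K : ℝ}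
    (hK : ∀ t ∈ Icc (0 : ℝ) 1, |u' t| ≤ K) :
    ∀ s ∈ Icc (0 : ℝ) 1, ∀ t ∈ Icc (0 : ℝ) 1, |u s - u t| ≤ K * |s - t| := fun _ hs _ ht =>
  (convex_Icc (0 : ℝ) 1).norm_image_sub_le_of_norm_hasDerivWithin_le hu.deriv₁ hK ht hs

lemma IsPeriodicC2.abs_deriv_sub_le {u u' u'' : ℝ → ℝ} (hu : IsPeriodicC2 u u' u'') {K : ℝ}
    (hK : ∀ t ∈ Icc (0 : ℝ) 1, |u'' t| ≤ K) :
    ∀ s ∈ Icc (0 : ℝ) 1, ∀ t ∈ Icc (0 : ℝ) 1, |u' s - u' t| ≤ K * |s - t| := fun _ hs _ ht =>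
  (convex_Icc (0 : ℝ) 1).norm_image_sub_le_of_norm_hasDerivWithin_le hu.deriv₂ hK ht hs

/-! ### Existence for bounded nonlinearities -/

/-- Banach's theorem with the source `h` as unknown: `h ↦ φ(t, U' h)` has Lipschitz constant at most
`2L / k ≤ 1 / 2`. -/
lemma exists_periodic_of_lipschitz_deriv {φ : ℝ → ℝ → ℝ} {L k : ℝ} (hk : 0 < k)
    (hLk : 4 * L ≤ k) (hφ : Continuous fun p : ℝ × ℝ => φ p.1 p.2)
    (hL : ∀ t y₁ y₂, |φ t y₁ - φ t y₂| ≤ L * |y₁ - y₂|) :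
    ∃ u u' : ℝ → ℝ, IsPeriodicC2 u u' (fun t => k ^ 2 * u t - φ t (u' t)) ∧
      Continuous u ∧ Continuous u' := by
  have hL0 : 0 ≤ L := by simpa using (abs_nonneg _).trans (hL 0 1 0)
  choose U U' hU hUc hUc' using fun h : C(Icc (0 : ℝ) 1, ℝ) =>
    exists_periodic_linear hk (h.continuous.Icc_extend' (h := zero_le_one))
  let Φ : C(Icc (0 : ℝ) 1, ℝ) → C(Icc (0 : ℝ) 1, ℝ) := fun h =>
    ⟨fun t => φ t (U' h t), by
      have := hUc' h
      exact hφ.comp (by fun_prop : Continuous fun t : Icc (0 : ℝ) 1 => ((t : ℝ), U' h t))⟩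
  have hΦ : ContractingWith (1 / 2) Φ := by
    refine ⟨by norm_num, LipschitzWith.of_dist_le_mul fun h₁ h₂ => ?_⟩
    rw [ContinuousMap.dist_le (by positivity)]
    intro t
    have hd := ((hU h₁).sub (hU h₂)).abs_le_of_linear hk (H := dist h₁ h₂) (fun s hs => by
      rw [show k ^ 2 * (U h₁ s - U h₂ s) - (k ^ 2 * U h₁ s - IccExtend zero_le_one h₁ s -
        (k ^ 2 * U h₂ s - IccExtend zero_le_one h₂ s)) =
        IccExtend zero_le_one h₁ s - IccExtend zero_le_one h₂ s by ring,
        IccExtend_of_mem _ _ hs, IccExtend_of_mem _ _ hs, ← Real.dist_eq]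
      exact ContinuousMap.dist_apply_le_dist _) t t.2
    rw [Real.dist_eq]
    calc |φ t (U' h₁ t) - φ t (U' h₂ t)| ≤ L * |U' h₁ t - U' h₂ t| := hL _ _ _
      _ ≤ L * (2 * dist h₁ h₂ / k) := by gcongr; exact hd.2
      _ = (2 * L / k) * dist h₁ h₂ := by ring
      _ ≤ (1 / 2) * dist h₁ h₂ := by
        refine mul_le_mul_of_nonneg_right ?_ dist_nonneg
        rw [div_le_div_iff₀ hk two_pos]
        linarith
      _ = _ := by norm_num
  set h := hΦ.fixedPoint
  have hfix : Φ h = h := hΦ.fixedPoint_isFixedPt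
  refine ⟨U h, U' h, (hU h).congr fun t ht => ?_, hUc h, hUc' h⟩
  rw [IccExtend_of_mem _ _ ht]
  congr 1
  exact (DFunLike.congr_fun hfix ⟨t, ht⟩).symm

lemma exists_subseq_uniform_limit {u : ℕ → ℝ → ℝ} {K : ℝ}
    (hb : ∀ n, ∀ t ∈ Icc (0 : ℝ) 1, |u n t| ≤ K)
    (hL : ∀ n, ∀ s ∈ Icc (0 : ℝ) 1, ∀ t ∈ Icc (0 : ℝ) 1, |u n s - u n t| ≤ K * |s - t|) :
    ∃ w : ℝ → ℝ, Continuous w ∧ ∃ φ : ℕ → ℕ, StrictMono φ ∧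
      ∀ ε > 0, ∃ N, ∀ n ≥ N, ∀ t ∈ Icc (0 : ℝ) 1, |u (φ n) t - w t| ≤ ε := by
  have hK : 0 ≤ K := (abs_nonneg _).trans (hb 0 0 ⟨le_rfl, zero_le_one⟩)
  have hlip : ∀ n, LipschitzWith K.toNNReal (fun t : Icc (0 : ℝ) 1 => u n t) := fun n =>
    LipschitzWith.of_dist_le_mul fun s t => by
      rw [Real.coe_toNNReal _ hK]
      exact hL n s s.2 t t.2
  let F : ℕ → BoundedContinuousFunction (Icc (0 : ℝ) 1) ℝ := fun n =>
    BoundedContinuousFunction.mkOfCompact ⟨fun t => u n t, (hlip n).continuous⟩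
  have hcomp : IsCompact (closure (range F)) := by
    refine BoundedContinuousFunction.arzela_ascoli (Icc (-K) K) isCompact_Icc _ ?_ ?_
    · rintro _ x ⟨n, rfl⟩
      exact abs_le.1 (hb n x x.2)
    · refine (LipschitzWith.uniformEquicontinuous _ K.toNNReal ?_).equicontinuous
      rintro ⟨_, n, rfl⟩
      exact hlip n
  obtain ⟨w, -, φ, hφ, hlim⟩ := hcomp.tendsto_subseq fun n => subset_closure (mem_range_self n)
  refine ⟨IccExtend zero_le_one w, w.continuous.Icc_extend', φ, hφ, fun ε hε => ?_⟩
  obtain ⟨N, hN⟩ := Metric.tendsto_atTop.1 hlim ε hε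
  refine ⟨N, fun n hn t ht => ?_⟩
  rw [IccExtend_of_mem _ _ ht]
  exact (BoundedContinuousFunction.dist_coe_le_dist (f := F (φ n)) (g := w) ⟨t, ht⟩).trans
    (hN n hn).le

/-- Inf-convolution `inf_q (g q + L dist p q)`: with `L = 2|M| / δ`, points farther than `δ` cannot
push the infimum below `g p`. -/
lemma exists_lipschitz_approx {X : Type*} [PseudoMetricSpace X] {g : X → ℝ} {M ε : ℝ}
    (hg : UniformContinuous g) (hM : ∀ p, |g p| ≤ M) (hε : 0 < ε) :
    ∃ (L : ℝ) (g' : X → ℝ), 0 ≤ L ∧ (∀ p q, |g' p - g' q| ≤ L * dist p q) ∧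
      ∀ p, |g p - g' p| ≤ ε := by
  obtain ⟨δ, hδ, hgδ⟩ := Metric.uniformContinuous_iff.1 hg ε hε
  set L := 2 * |M| / δ with hLdef
  have hL : 0 ≤ L := by positivity
  have hbdd : ∀ p, BddBelow (range fun q => g q + L * dist p q) := fun p => ⟨-M, by
    rintro _ ⟨q, rfl⟩
    have := (abs_le.1 (hM q)).1
    have : 0 ≤ L * dist p q := by positivity
    dsimp only
    linarith⟩
  have hle : ∀ p q, (⨅ r, g r + L * dist p r) ≤ (⨅ r, g r + L * dist q r) + L * dist p q := by
    intro p q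
    have : Nonempty X := ⟨p⟩
    rw [← sub_le_iff_le_add]
    refine le_ciInf fun r => ?_
    have h1 := ciInf_le (hbdd p) r
    have h2 := mul_le_mul_of_nonneg_left (dist_triangle p q r) hL
    linarith
  refine ⟨L, fun p => ⨅ q, g q + L * dist p q, hL, fun p q => ?_, fun p => ?_⟩
  · have h1 := hle p q
    have h2 := hle q p
    rw [dist_comm q p] at h2
    exact abs_le.2 ⟨by linarith, by linarith⟩
  · have : Nonempty X := ⟨p⟩
    have h1 := ciInf_le (hbdd p) p
    rw [dist_self, mul_zero, add_zero] at h1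
    have h2 : g p - ε ≤ ⨅ q, g q + L * dist p q := by
      refine le_ciInf fun q => ?_
      rcases lt_or_ge (dist p q) δ with h | h
      · have h3 := hgδ h
        rw [Real.dist_eq, abs_lt] at h3
        have : 0 ≤ L * dist p q := by positivity
        linarith [h3.2]
      · have h3 : 2 * |M| ≤ L * dist p q := by
          calc 2 * |M| = L * δ := by rw [hLdef]; field_simp
            _ ≤ L * dist p q := by gcongr
        have h4 := (abs_le.1 (hM q)).1
        have h5 := (abs_le.1 (hM p)).2
        linarith [le_abs_self M]
    exact abs_le.2 ⟨by linarith, by linarith⟩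

/-- For `g` Lipschitz and bounded, `-u'' + u = g(t, u, u')` has approximate periodic solutions,
obtained by monotone iteration. -/
lemma exists_approx_solution_of_lipschitz {g : ℝ × ℝ × ℝ → ℝ} {L M ε : ℝ} (hL0 : 0 ≤ L)
    (hL : ∀ p q, |g p - g q| ≤ L * dist p q) (hM : ∀ p, |g p| ≤ M) (hε : 0 < ε) :
    ∃ u u' h : ℝ → ℝ, IsPeriodicC2 u u' (fun t => u t - h t) ∧
      ∀ t ∈ Icc (0 : ℝ) 1, |h t - g (t, u t, u' t)| ≤ ε := by
  -- Large enough for the contraction (`4L ≤ k`) and for monotonicity of the iteration (`L ≤ k² -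
  -- 1`).
  set k : ℝ := 4 * L + 2
  have hk : 0 < k := by positivity
  have hkL : L ≤ k ^ 2 - 1 := by simp only [k]; nlinarith
  have hM0 : 0 ≤ M := (abs_nonneg _).trans (hM 0)
  have hgc : Continuous g := by
    refine (LipschitzWith.of_dist_le_mul (K := L.toNNReal) fun p q => ?_).continuous
    rw [Real.coe_toNNReal _ hL0]
    exact hL p q
  have hgx : ∀ t x₁ x₂ y, |g (t, x₁, y) - g (t, x₂, y)| ≤ L * |x₁ - x₂| := fun t x₁ x₂ y => by
    simpa [Prod.dist_eq, Real.dist_eq] using hL (t, x₁, y) (t, x₂, y)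
  -- The iteration lags in `u` but is implicit in `u'`: no monotonicity of `g` in `u'` is needed,
  -- since `u'` agrees for both functions where the maximum principle is tested.
  choose T T' hT hTc' using fun v : C(ℝ, ℝ) => show ∃ (u : C(ℝ, ℝ)) (u' : ℝ → ℝ),
      IsPeriodicC2 u u' (fun t => k ^ 2 * u t - (g (t, v t, u' t) + (k ^ 2 - 1) * v t)) ∧
        Continuous u' by
    obtain ⟨u, u', hu, huc, huc'⟩ := exists_periodic_of_lipschitz_deriv
      (φ := fun t y => g (t, v t, y) + (k ^ 2 - 1) * v t) (L := L) hk (by simp only [k]; linarith)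
      (by fun_prop) (fun t y₁ y₂ => by
        simpa [Prod.dist_eq, Real.dist_eq] using hL (t, v t, y₁) (t, v t, y₂))
    exact ⟨⟨u, huc⟩, u', hu, huc'⟩
  have hmono : ∀ v₁ v₂ : C(ℝ, ℝ), (∀ t ∈ Icc (0 : ℝ) 1, v₁ t ≤ v₂ t) →
      ∀ t ∈ Icc (0 : ℝ) 1, T v₁ t ≤ T v₂ t := by
    intro v₁ v₂ hv t ht
    have hd := (hT v₁).sub (hT v₂)
    refine sub_nonpos.1 (nonpos_of_deriv₂_pos hd.deriv₁ hd.deriv₂ hd.bdry hd.bdry'.ge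
      (fun s hs hpos hz => ?_) t ht)
    have hy : T' v₁ s = T' v₂ s := sub_eq_zero.1 hz
    have h1 := (abs_le.1 (hgx s (v₁ s) (v₂ s) (T' v₂ s))).2
    rw [abs_of_nonpos (sub_nonpos.2 (hv s hs))] at h1
    have h2 := mul_le_mul_of_nonneg_right hkL (sub_nonneg.2 (hv s hs))
    have h3 : 0 < k ^ 2 * (T v₁ s - T v₂ s) := by positivity
    simp only [hy]
    linarith
  have hk1 : 0 ≤ k ^ 2 - 1 := hL0.trans hkL
  have hle : ∀ v : C(ℝ, ℝ), (∀ t ∈ Icc (0 : ℝ) 1, |v t| ≤ M) →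
      ∀ t ∈ Icc (0 : ℝ) 1, |T v t| ≤ M ∧ |T' v t| ≤ 2 * (k ^ 2 * M) / k := by
    intro v hv t ht
    have h := (hT v).abs_le_of_linear hk (H := k ^ 2 * M) (fun s hs => by
      rw [sub_sub_cancel]
      calc |g (s, v s, T' v s) + (k ^ 2 - 1) * v s|
          ≤ |g (s, v s, T' v s)| + (k ^ 2 - 1) * |v s| := by
            refine (abs_add_le _ _).trans_eq ?_
            rw [abs_mul, abs_of_nonneg hk1]
        _ ≤ M + (k ^ 2 - 1) * M := by
            gcongr
            · exact hM _
            · exact hv s hs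
        _ = k ^ 2 * M := by ring) t ht
    rwa [mul_div_cancel_left₀ _ (by positivity)] at h
  let V : ℕ → C(ℝ, ℝ) := fun n => T^[n] (ContinuousMap.const ℝ (-M))
  have hVs : ∀ n, V (n + 1) = T (V n) := fun n => Function.iterate_succ_apply' _ _ _
  have hVb : ∀ n, ∀ t ∈ Icc (0 : ℝ) 1, |V n t| ≤ M := by
    intro n
    induction n with
    | zero => intro t _; simp [V, abs_of_nonneg hM0]
    | succ n ih => intro t ht; rw [hVs]; exact (hle _ ih t ht).1
  have hVm : ∀ t ∈ Icc (0 : ℝ) 1, Monotone fun n => V n t := by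
    intro t ht
    refine monotone_nat_of_le_succ fun n => ?_
    induction n generalizing t with
    | zero =>
      have := (abs_le.1 (hVb 1 t ht)).1
      simpa [V] using this
    | succ n ih => rw [hVs, hVs]; exact hmono _ _ ih t ht
  set K := M + 2 * (k ^ 2 * M) / k
  have hK1 : M ≤ K := le_add_of_nonneg_right (by positivity)
  have hK2 : 2 * (k ^ 2 * M) / k ≤ K := le_add_of_nonneg_left hM0
  obtain ⟨w, -, φ, hφ, hlim⟩ := exists_subseq_uniform_limit (u := fun n => V (n + 1)) (K := K)
    (fun n t ht => (hVb _ t ht).trans hK1)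
    (fun n => by
      simp only [hVs]
      exact (hT (V n)).abs_sub_le fun t ht => (hle _ (hVb n) t ht).2.trans hK2)
  obtain ⟨N, hN⟩ := hlim (ε / (4 * k ^ 2)) (by positivity)
  set m := φ N + 1
  -- Monotonicity squeezes `V (m + 1)` between two members of the convergent subsequence, so
  -- consecutive iterates are close.
  have hclose : ∀ t ∈ Icc (0 : ℝ) 1, |V m t - T (V m) t| ≤ ε / (2 * k ^ 2) := by
    intro t ht
    have h1 := hN N le_rfl t ht
    have h2 := hN (N + 1) (Nat.le_succ N) t ht
    have h3 : V m t ≤ V (m + 1) t := hVm t ht (Nat.le_succ m)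
    have h4 : V (m + 1) t ≤ V (φ (N + 1) + 1) t :=
      hVm t ht (Nat.succ_le_succ (hφ (Nat.lt_succ_self N)))
    rw [← hVs, abs_of_nonpos (by linarith)]
    rw [abs_le] at h1 h2
    have : ε / (2 * k ^ 2) = ε / (4 * k ^ 2) + ε / (4 * k ^ 2) := by ring_nf
    linarith [h1.1, h2.2]
  refine ⟨T (V m), T' (V m), fun t => g (t, V m t, T' (V m) t) +
    (k ^ 2 - 1) * (V m t - T (V m) t), (hT (V m)).congr fun t _ => by ring, fun t ht => ?_⟩
  rw [add_sub_right_comm]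
  calc _ ≤ L * |V m t - T (V m) t| + (k ^ 2 - 1) * |V m t - T (V m) t| := by
        refine (abs_add_le _ _).trans (add_le_add (hgx _ _ _ _) ?_)
        rw [abs_mul, abs_of_nonneg hk1]
    _ = (L + (k ^ 2 - 1)) * |V m t - T (V m) t| := by ring
    _ ≤ (2 * k ^ 2) * (ε / (2 * k ^ 2)) := by
        gcongr
        · linarith
        · exact hclose t ht
    _ = ε := by field_simp

/-- For `g` uniformly continuous and bounded, `-u'' + u = g(t, u, u')` has a periodic solution. -/
theorem exists_periodic_solution_of_bounded {g : ℝ × ℝ × ℝ → ℝ} {M : ℝ}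
    (hg : UniformContinuous g) (hM : ∀ p, |g p| ≤ M) :
    ∃ u u' : ℝ → ℝ, IsPeriodicC2 u u' (fun t => u t - g (t, u t, u' t)) := by
  have hM0 : 0 ≤ M := (abs_nonneg _).trans (hM 0)
  have happ : ∀ n : ℕ, ∃ u u' h : ℝ → ℝ, IsPeriodicC2 u u' (fun t => u t - h t) ∧
      ∀ t ∈ Icc (0 : ℝ) 1, |h t - g (t, u t, u' t)| ≤ 1 / ((n : ℝ) + 1) := by
    intro n
    have hpos : 0 < 1 / ((n : ℝ) + 1) / 2 := by positivity
    obtain ⟨L, g', hL0, hL, hgg⟩ := exists_lipschitz_approx hg hM hpos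
    obtain ⟨u, u', h, hu, hh⟩ := exists_approx_solution_of_lipschitz hL0 hL
      (M := M + 1 / ((n : ℝ) + 1) / 2)
      (fun p => by
        have h1 := abs_le.1 (hgg p)
        have h2 := abs_le.1 (hM p)
        exact abs_le.2 ⟨by linarith, by linarith⟩) hpos
    refine ⟨u, u', h, hu, fun t ht => ?_⟩
    have h1 := abs_le.1 (hgg (t, u t, u' t))
    have h2 := abs_le.1 (hh t ht)
    exact abs_le.2 ⟨by linarith, by linarith⟩
  choose u u' h hu hh using happ
  have hhb : ∀ n, ∀ t ∈ Icc (0 : ℝ) 1, |h n t| ≤ M + 1 := by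
    intro n t ht
    have h1 := abs_le.1 (hh n t ht)
    have h2 := abs_le.1 (hM (t, u n t, u' n t))
    have h3 : 1 / ((n : ℝ) + 1) ≤ 1 := by
      rw [div_le_one (by positivity)]
      simp
    exact abs_le.2 ⟨by linarith, by linarith⟩
  have hub : ∀ n, ∀ t ∈ Icc (0 : ℝ) 1, |u n t| ≤ M + 1 ∧ |u' n t| ≤ 2 * (M + 1) := by
    intro n t ht
    simpa using (hu n).abs_le_of_linear one_pos (H := M + 1)
      (fun s hs => by simpa using hhb n s hs) t ht
  have hub'' : ∀ n, ∀ t ∈ Icc (0 : ℝ) 1, |u n t - h n t| ≤ 2 * (M + 1) := fun n t ht =>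
    (abs_sub _ _).trans (by linarith [(hub n t ht).1, hhb n t ht])
  obtain ⟨w, hw, φ, hφ, hlim⟩ := exists_subseq_uniform_limit (u := u) (K := 2 * (M + 1))
    (fun n t ht => (hub n t ht).1.trans (by linarith))
    (fun n => (hu n).abs_sub_le fun t ht => (hub n t ht).2)
  obtain ⟨w', hw', ψ, hψ, hlim'⟩ := exists_subseq_uniform_limit (u := fun n => u' (φ n))
    (K := 2 * (M + 1)) (fun n t ht => (hub _ t ht).2)
    (fun n => (hu _).abs_deriv_sub_le fun t ht => hub'' _ t ht)
  have hgc := hg.continuous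
  -- Solve the linear problem with the limiting source; its stability estimate identifies `v, v'`
  -- with `w, w'`, so the limits need not be differentiated.
  obtain ⟨v, v', hv, -, -⟩ := exists_periodic_linear one_pos
    (h := fun t => g (t, w t, w' t)) (by fun_prop)
  have key : ∀ t ∈ Icc (0 : ℝ) 1, v t = w t ∧ v' t = w' t := by
    suffices ∀ ε > 0, ∀ t ∈ Icc (0 : ℝ) 1, |v t - w t| ≤ ε ∧ |v' t - w' t| ≤ ε from fun t ht =>
      ⟨sub_eq_zero.1 (abs_nonpos_iff.1 (le_of_forall_pos_le_add fun ε hε => by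
          simpa using (this ε hε t ht).1)),
        sub_eq_zero.1 (abs_nonpos_iff.1 (le_of_forall_pos_le_add fun ε hε => by
          simpa using (this ε hε t ht).2))⟩
    intro ε hε
    obtain ⟨δ, hδ, hgδ⟩ := Metric.uniformContinuous_iff.1 hg (ε / 8) (by positivity)
    obtain ⟨η, hη, hη₁, hη₂⟩ : ∃ η > 0, η < δ ∧ η ≤ ε / 2 :=
      ⟨min (δ / 2) (ε / 2), by positivity, (min_le_left _ _).trans_lt (by linarith),
        min_le_right _ _⟩
    obtain ⟨N₁, hN₁⟩ := hlim η hη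
    obtain ⟨N₂, hN₂⟩ := hlim' η hη
    obtain ⟨N₃, hN₃⟩ := exists_nat_one_div_lt (show 0 < ε / 8 by positivity)
    set n := max N₁ (max N₂ N₃)
    set m := φ (ψ n)
    have hn₁ : N₁ ≤ ψ n := (le_max_left _ _).trans (hψ.id_le n)
    have hn₂ : N₂ ≤ n := (le_max_left _ _).trans (le_max_right _ _)
    have hn₃ : N₃ ≤ m := ((le_max_right _ _).trans (le_max_right _ _)).trans
      ((hψ.id_le n).trans (hφ.id_le _))
    have hsmall : 1 / ((m : ℝ) + 1) ≤ ε / 8 :=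
      (one_div_le_one_div_of_le (by positivity) (by gcongr)).trans hN₃.le
    -- `ε / 4` is `ε / 8` from the approximate equation plus `ε / 8` from uniform continuity of `g`.
    have hest := (hv.sub (hu m)).abs_le_of_linear one_pos (H := ε / 4) (fun s hs => by
      have h1 := hh m s hs
      have h2 : dist (s, u m s, u' m s) (s, w s, w' s) < δ := by
        rw [Prod.dist_eq, Prod.dist_eq]
        simp only [dist_self, Real.dist_eq]
        exact max_lt hδ (max_lt ((hN₁ _ hn₁ s hs).trans_lt hη₁) ((hN₂ _ hn₂ s hs).trans_lt hη₁))
      have h3 := hgδ h2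
      rw [Real.dist_eq, abs_lt] at h3
      rw [abs_le] at h1 ⊢
      simp only [one_pow, one_mul]
      constructor <;> linarith [h3.1, h3.2, h1.1, h1.2])
    intro t ht
    have h1 := hest t ht
    simp only [one_pow, div_one] at h1
    have h2 := hN₁ _ hn₁ t ht
    have h3 := hN₂ _ hn₂ t ht
    refine ⟨(abs_sub_le _ (u m t) _).trans ?_, (abs_sub_le _ (u' m t) _).trans ?_⟩
    · linarith [h1.1]
    · linarith [h1.2]
  refine ⟨v, v', hv.congr fun t ht => ?_⟩
  rw [(key t ht).1, (key t ht).2]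
  ring

/-! ### One-sided Nagumo estimates -/

/-- Up to the first point after `a` where `φ ≤ K`, `φ` is nondecreasing, so it could not have come
down to `K`. -/
lemma lt_of_deriv_nonneg_above {φ φ' : ℝ → ℝ} {K a : ℝ}
    (hφ : ∀ t ∈ Icc (0 : ℝ) 1, HasDerivWithinAt φ (φ' t) (Icc 0 1) t)
    (H : ∀ t ∈ Icc (0 : ℝ) 1, K < φ t → 0 ≤ φ' t) (ha : 0 ≤ a) (hKa : K < φ a) :
    ∀ t ∈ Icc a 1, K < φ t := by
  intro b hb
  by_contra hKb
  have hcont : ContinuousOn φ (Icc 0 1) := fun t ht => (hφ t ht).continuousWithinAt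
  have hsub : Icc a b ⊆ Icc 0 1 := Icc_subset_Icc ha hb.2
  obtain ⟨s, ⟨hs, hsK⟩, hmin⟩ :=
    ((hcont.mono hsub).lowerSemicontinuousOn.isCompact_inter_preimage_Iic isCompact_Icc K
      ).exists_isLeast ⟨b, ⟨hb.1, le_rfl⟩, not_lt.1 hKb⟩
  have hsub' : Icc a s ⊆ Icc 0 1 := (Icc_subset_Icc_right hs.2).trans hsub
  have hder : ∀ t ∈ Ioo a s, HasDerivAt φ (φ' t) t := fun t ht =>
    (hφ t (hsub' ⟨ht.1.le, ht.2.le⟩)).hasDerivAt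
      (Icc_mem_nhds (ha.trans_lt ht.1) (ht.2.trans_le (hs.2.trans hb.2)))
  have hmono : MonotoneOn φ (Icc a s) := by
    refine monotoneOn_of_deriv_nonneg (convex_Icc a s) (hcont.mono hsub') ?_ ?_ <;>
      rw [interior_Icc]
    · exact fun t ht => (hder t ht).differentiableAt.differentiableWithinAt
    · intro t ht
      rw [(hder t ht).deriv]
      refine H t (hsub' ⟨ht.1.le, ht.2.le⟩) (not_le.1 fun hle => ?_)
      exact (hmin ⟨⟨ht.1.le, ht.2.le.trans hs.2⟩, hle⟩).not_gt ht.2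
  exact (hKa.trans_le (hmono ⟨le_rfl, hs.1⟩ ⟨hs.1, le_rfl⟩ hs.1)).not_ge hsK

/-- A one-sided Nagumo estimate for periodic functions. -/
lemma IsPeriodicC2.deriv_le {x x' x'' : ℝ → ℝ} (hx : IsPeriodicC2 x x' x'') {A B Y C : ℝ}
    (hC : 0 ≤ C) (hY : 0 < Y) (hAB : ∀ t ∈ Icc (0 : ℝ) 1, A ≤ x t ∧ x t ≤ B)
    (H : ∀ t ∈ Icc (0 : ℝ) 1, Y ≤ x' t → -(C * x' t ^ 2) ≤ x'' t) :
    ∀ t ∈ Icc (0 : ℝ) 1, x' t ≤ Y * Real.exp (C * (B - A)) := by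
  intro τ hτ
  by_contra hlt
  rw [not_le] at hlt
  -- The integrating factor turns `x'' + C x'² ≥ 0` into `φ' ≥ 0`; `K` is chosen so that `φ > K`
  -- forces `x' > Y`.
  set φ : ℝ → ℝ := fun t => x' t * Real.exp (C * x t) with hφdef
  set K := Y * Real.exp (C * B)
  have hφ : ∀ t ∈ Icc (0 : ℝ) 1, HasDerivWithinAt φ
      ((x'' t + C * x' t ^ 2) * Real.exp (C * x t)) (Icc 0 1) t := fun t ht =>
    ((hx.deriv₂ t ht).mul ((hx.deriv₁ t ht).const_mul C).exp).congr_deriv (by ring)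
  have hYx : ∀ t ∈ Icc (0 : ℝ) 1, K < φ t → Y < x' t := by
    intro t ht hK
    have h1 : Real.exp (C * x t) ≤ Real.exp (C * B) :=
      Real.exp_le_exp.2 (mul_le_mul_of_nonneg_left (hAB t ht).2 hC)
    have h2 : Y * Real.exp (C * x t) < x' t * Real.exp (C * x t) :=
      (mul_le_mul_of_nonneg_left h1 hY.le).trans_lt hK
    exact lt_of_mul_lt_mul_right h2 (Real.exp_pos _).le
  have Hφ : ∀ t ∈ Icc (0 : ℝ) 1, K < φ t →
      0 ≤ (x'' t + C * x' t ^ 2) * Real.exp (C * x t) := fun t ht hK =>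
    mul_nonneg (by linarith [H t ht (hYx t ht hK).le]) (Real.exp_pos _).le
  have hτK : K < φ τ := by
    have h1 : Real.exp (C * A) ≤ Real.exp (C * x τ) :=
      Real.exp_le_exp.2 (mul_le_mul_of_nonneg_left (hAB τ hτ).1 hC)
    calc K = Y * Real.exp (C * (B - A)) * Real.exp (C * A) := by
          rw [mul_assoc, ← Real.exp_add]; ring_nf; rfl
      _ ≤ Y * Real.exp (C * (B - A)) * Real.exp (C * x τ) := by gcongr
      _ < x' τ * Real.exp (C * x τ) := by gcongr
  -- Being above `K` persists to `1`, transfers to `0`, then spreads to all of `[0,1]`; so `x' > Y >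
  -- 0` everywhere.
  have h1 : K < φ 1 := lt_of_deriv_nonneg_above hφ Hφ hτ.1 hτK 1 ⟨hτ.2, le_rfl⟩
  have h0 : K < φ 0 := by simpa only [hφdef, hx.bdry, hx.bdry'] using h1
  have hall := lt_of_deriv_nonneg_above hφ Hφ le_rfl h0
  obtain ⟨s, hs, hslope⟩ := exists_hasDerivAt_eq_slope x x' zero_lt_one hx.continuousOn
    (fun s hs => (hx.deriv₁ s ⟨hs.1.le, hs.2.le⟩).hasDerivAt (Icc_mem_nhds hs.1 hs.2))
  have := hYx s ⟨hs.1.le, hs.2.le⟩ (hall s ⟨hs.1.le, hs.2.le⟩)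
  rw [hslope, hx.bdry] at this
  simp only [sub_self, zero_div] at this
  linarith

lemma IsPeriodicC2.abs_deriv_le {x x' x'' : ℝ → ℝ} (hx : IsPeriodicC2 x x' x'') {A B Y C : ℝ}
    (hC : 0 ≤ C) (hY : 0 < Y) (hAB : ∀ t ∈ Icc (0 : ℝ) 1, A ≤ x t ∧ x t ≤ B)
    (H : ∀ t ∈ Icc (0 : ℝ) 1, (Y ≤ x' t → -(C * x' t ^ 2) ≤ x'' t) ∧
      (x' t ≤ -Y → x'' t ≤ C * x' t ^ 2)) :
    ∀ t ∈ Icc (0 : ℝ) 1, |x' t| ≤ Y * Real.exp (C * (B - A)) := by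
  intro t ht
  have h1 := hx.deriv_le hC hY hAB (fun t ht => (H t ht).1) t ht
  have h2 := hx.neg.deriv_le (A := -B) (B := -A) hC hY
    (fun t ht => ⟨neg_le_neg (hAB t ht).2, neg_le_neg (hAB t ht).1⟩)
    (fun t ht h => by
      have := (H t ht).2 (by linarith)
      rw [neg_sq]
      linarith) t ht
  rw [show -A - -B = B - A by ring] at h2
  exact abs_le.2 ⟨by linarith, h1⟩

/-- Time reversal flips the sign of `x'` and keeps that of `x''`. -/
lemma IsPeriodicC2.abs_deriv_le_of_reflect {x x' x'' : ℝ → ℝ} (hx : IsPeriodicC2 x x' x'')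
    {A B Y C : ℝ} (hC : 0 ≤ C) (hY : 0 < Y) (hAB : ∀ t ∈ Icc (0 : ℝ) 1, A ≤ x t ∧ x t ≤ B)
    (H : ∀ t ∈ Icc (0 : ℝ) 1, (Y ≤ x' t → x'' t ≤ C * x' t ^ 2) ∧
      (x' t ≤ -Y → -(C * x' t ^ 2) ≤ x'' t)) :
    ∀ t ∈ Icc (0 : ℝ) 1, |x' t| ≤ Y * Real.exp (C * (B - A)) := by
  intro t ht
  have h := hx.reflect.abs_deriv_le hC hY (fun t ht => hAB _ (one_sub_mem_Icc ht))
    (fun t ht => by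
      have := H _ (one_sub_mem_Icc ht)
      rw [neg_sq]
      exact ⟨fun h => this.2 (by linarith), fun h => this.1 (by linarith)⟩)
    (1 - t) (one_sub_mem_Icc ht)
  simpa using h

/-! ### From the asymptotic hypotheses to one-sided growth -/

/-- On the region, `y f(t,x,y) ≤ C |y|³` for `|y| ≥ Y`. -/
def OneSidedGrowth (Γ : Set (ℝ × ℝ)) (f : ℝ → ℝ → ℝ → ℝ) (Y C : ℝ) : Prop :=
  ∀ t x : ℝ, (t, x) ∈ Γ → ∀ y : ℝ, (Y ≤ y → f t x y ≤ C * y ^ 2) ∧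
    (y ≤ -Y → -(C * y ^ 2) ≤ f t x y)

/-- For `y ≥ Y`, `f₂(y) ≤ f₂(-Y) = f(-Y) - f₁(-Y)`, where `f(-Y)` is bounded by compactness and
`f₁(-Y)` from below by the growth bound; symmetrically for `y ≤ -Y`. -/
lemma exists_oneSidedGrowth {f f₁ f₂ : ℝ → ℝ → ℝ → ℝ} {Γ : Set (ℝ × ℝ)} {c : ℝ → ℝ} {C₁ R : ℝ}
    (hf : ContinuousOn (fun p : ℝ × ℝ × ℝ => f p.1 p.2.1 p.2.2) (Icc (0 : ℝ) 1 ×ˢ univ))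
    (hsum : ∀ t ∈ Icc (0 : ℝ) 1, ∀ x y : ℝ, f t x y = f₁ t x y + f₂ t x y)
    (hΓ : ∀ t x, (t, x) ∈ Γ → t ∈ Icc (0 : ℝ) 1 ∧ x ∈ Icc (-R) R)
    (hc : ∀ t ∈ Icc (0 : ℝ) 1, c t ≤ C₁) (h₁ : UniformLimsupLE Γ f₁ c)
    (h₂ : ∀ t x : ℝ, (t, x) ∈ Γ → Antitone (f₂ t x)) :
    ∃ Y > 0, ∃ C ≥ 0, OneSidedGrowth Γ f Y C := by
  obtain ⟨Y, hY, hlim⟩ := h₁ 1 one_pos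
  obtain ⟨M, hM⟩ := (isCompact_Icc.prod (isCompact_Icc.prod isCompact_Icc) : IsCompact
    (Icc (0 : ℝ) 1 ×ˢ Icc (-R) R ×ˢ Icc (-Y) Y)).exists_bound_of_continuousOn
    (hf.mono (prod_mono subset_rfl (subset_univ _)))
  set D := |C₁ + 1|
  have hgrow : ∀ t x, (t, x) ∈ Γ → ∀ y, Y ≤ |y| → y * f₁ t x y ≤ D * |y| ^ 3 := by
    intro t x htx y hy
    have hpos : 0 < |y| := hY.trans_le hy
    have h := hlim t x htx y hy
    rw [div_le_iff₀ (by positivity)] at h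
    refine h.trans (mul_le_mul_of_nonneg_right ?_ (by positivity))
    exact (add_le_add_left (hc t (hΓ t x htx).1) 1).trans (le_abs_self _)
  have hup : ∀ t x, (t, x) ∈ Γ → ∀ y, Y ≤ y → f₁ t x y ≤ D * y ^ 2 := by
    intro t x htx y hy
    have hpos : 0 < y := hY.trans_le hy
    have h := hgrow t x htx y (by rwa [abs_of_pos hpos])
    rw [abs_of_pos hpos] at h
    exact le_of_mul_le_mul_left (h.trans_eq (by ring)) hpos
  have hdown : ∀ t x, (t, x) ∈ Γ → ∀ y, y ≤ -Y → -(D * y ^ 2) ≤ f₁ t x y := by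
    intro t x htx y hy
    have hneg : y < 0 := by linarith
    have h := hgrow t x htx y (by rw [abs_of_neg hneg]; linarith)
    rw [abs_of_neg hneg] at h
    have : (-y) * -(D * y ^ 2) ≤ (-y) * f₁ t x y := by nlinarith
    exact le_of_mul_le_mul_left this (by linarith)
  have hYy : ∀ y : ℝ, Y ^ 2 ≤ y ^ 2 → |M| + D * Y ^ 2 ≤ (|M| / Y ^ 2 + D) * y ^ 2 := by
    intro y hy
    calc |M| + D * Y ^ 2 = (|M| / Y ^ 2 + D) * Y ^ 2 := by field_simp
      _ ≤ _ := by gcongr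
  have hbound : ∀ t x, (t, x) ∈ Γ → ∀ y ∈ Icc (-Y) Y, |f t x y| ≤ |M| := fun t x htx y hy =>
    (hM (t, x, y) ⟨(hΓ t x htx).1, (hΓ t x htx).2, hy⟩).trans (le_abs_self M)
  refine ⟨Y, hY, D + (|M| / Y ^ 2 + D), by positivity, fun t x htx y => ⟨fun hy => ?_, fun hy => ?_⟩⟩
  · have a := hup t x htx y hy
    have b := hdown t x htx (-Y) le_rfl
    have e := h₂ t x htx (show -Y ≤ y by linarith)
    have s := hsum t (hΓ t x htx).1 x y
    have s' := hsum t (hΓ t x htx).1 x (-Y)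
    have d := (abs_le.1 (hbound t x htx (-Y) ⟨le_rfl, by linarith⟩)).2
    have q := hYy y (by gcongr)
    rw [neg_sq] at b
    linarith
  · have a := hdown t x htx y hy
    have b := hup t x htx Y le_rfl
    have e := h₂ t x htx (show y ≤ Y by linarith)
    have s := hsum t (hΓ t x htx).1 x y
    have s' := hsum t (hΓ t x htx).1 x Y
    have d := (abs_le.1 (hbound t x htx Y ⟨by linarith, le_rfl⟩)).1
    have q := hYy y (by nlinarith)
    linarith

/-! ### Truncation and the method of lower and upper solutions -/

lemma max_min_projIcc {a b l r x : ℝ} (hlr : l ≤ r) (ha : l ≤ a) (hab : a ≤ b) (hb : b ≤ r) :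
    max a (min b (projIcc l r hlr x : ℝ)) = max a (min b x) := by
  rw [coe_projIcc]
  grind

/-- Such a `g` factors through a Lipschitz projection onto a compact box. -/
lemma uniformContinuous_of_comp_projIcc {g : ℝ × ℝ × ℝ → ℝ} (hg : Continuous g) {R N : ℝ}
    (hR : -R ≤ R) (hN : -N ≤ N)
    (h : ∀ t x y, g ((projIcc (0 : ℝ) 1 zero_le_one t : ℝ), (projIcc (-R) R hR x : ℝ),
      (projIcc (-N) N hN y : ℝ)) = g (t, x, y)) :
    UniformContinuous g ∧ ∃ M, ∀ p, |g p| ≤ M := by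
  let π : ℝ × ℝ × ℝ → Icc (0 : ℝ) 1 × Icc (-R) R × Icc (-N) N := fun p =>
    (projIcc 0 1 zero_le_one p.1, projIcc (-R) R hR p.2.1, projIcc (-N) N hN p.2.2)
  let G : Icc (0 : ℝ) 1 × Icc (-R) R × Icc (-N) N → ℝ := fun q => g (q.1, q.2.1, q.2.2)
  have hG : Continuous G := by fun_prop
  have hπ : UniformContinuous π :=
    ((LipschitzWith.projIcc zero_le_one).uniformContinuous.comp uniformContinuous_fst).prodMk
      (((LipschitzWith.projIcc hR).uniformContinuous.comp
        (uniformContinuous_fst.comp uniformContinuous_snd)).prodMk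
      ((LipschitzWith.projIcc hN).uniformContinuous.comp
        (uniformContinuous_snd.comp uniformContinuous_snd)))
  have hGπ : G ∘ π = g := funext fun p => h p.1 p.2.1 p.2.2
  rw [← hGπ]
  refine ⟨(CompactSpace.uniformContinuous_of_continuous hG).comp hπ, ?_⟩
  obtain ⟨M, hM⟩ := isCompact_univ.exists_bound_of_continuousOn hG.continuousOn
  exact ⟨M, fun p => hM _ (mem_univ _)⟩

lemma hasDerivWithinAt_d1 {α : ℝ → ℝ} (h : ContDiffOn ℝ 2 α (Icc 0 1)) {t : ℝ}
    (ht : t ∈ Icc (0 : ℝ) 1) : HasDerivWithinAt α (d1 α t) (Icc 0 1) t :=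
  (h.differentiableOn (by norm_num) t ht).hasDerivWithinAt

lemma contDiffOn_d1 {α : ℝ → ℝ} (h : ContDiffOn ℝ 2 α (Icc 0 1)) :
    ContDiffOn ℝ 1 (d1 α) (Icc 0 1) :=
  ((contDiffOn_succ_iff_derivWithin (n := 1) (uniqueDiffOn_Icc zero_lt_one)).1
    (by simpa [one_add_one_eq_two] using h)).2.2

lemma hasDerivWithinAt_d2 {α : ℝ → ℝ} (h : ContDiffOn ℝ 2 α (Icc 0 1)) {t : ℝ}
    (ht : t ∈ Icc (0 : ℝ) 1) : HasDerivWithinAt (d1 α) (d2 α t) (Icc 0 1) t :=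
  ((contDiffOn_d1 h).differentiableOn (by norm_num) t ht).hasDerivWithinAt

lemma IsPeriodicC2.isSolution {f : ℝ → ℝ → ℝ → ℝ}
    (hf : ContinuousOn (fun p : ℝ × ℝ × ℝ => f p.1 p.2.1 p.2.2) (Icc (0 : ℝ) 1 ×ˢ univ))
    {u u' : ℝ → ℝ} (hu : IsPeriodicC2 u u' (fun t => -f t (u t) (u' t))) :
    IsSolution f u := by
  have hud := uniqueDiffOn_Icc (zero_lt_one' ℝ)
  have e1 : ∀ t ∈ Icc (0 : ℝ) 1, d1 u t = u' t := fun t ht =>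
    (hu.deriv₁ t ht).derivWithin (hud t ht)
  have h2 : ∀ t ∈ Icc (0 : ℝ) 1, HasDerivWithinAt (d1 u) (-f t (u t) (u' t)) (Icc 0 1) t :=
    fun t ht => (hu.deriv₂ t ht).congr e1 (e1 t ht)
  have e2 : ∀ t ∈ Icc (0 : ℝ) 1, d2 u t = -f t (u t) (u' t) := fun t ht =>
    (h2 t ht).derivWithin (hud t ht)
  have hcf : ContinuousOn (fun t => -f t (u t) (u' t)) (Icc 0 1) :=
    (hf.comp (continuousOn_id.prodMk (hu.continuousOn.prodMk hu.continuousOn'))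
      (fun t ht => ⟨ht, mem_univ _⟩)).neg
  refine ⟨?_, fun t ht => by rw [e2 t ht, e1 t ht, neg_neg], hu.bdry, ?_⟩
  · rw [← one_add_one_eq_two, contDiffOn_succ_iff_derivWithin hud]
    refine ⟨fun t ht => (hu.deriv₁ t ht).differentiableWithinAt, by simp, ?_⟩
    rw [← zero_add (1 : WithTop ℕ∞), contDiffOn_succ_iff_derivWithin hud]
    exact ⟨fun t ht => (h2 t ht).differentiableWithinAt, by simp,
      contDiffOn_zero.2 (hcf.congr e2)⟩
  · rw [e1 0 ⟨le_rfl, zero_le_one⟩, e1 1 ⟨zero_le_one, le_rfl⟩, hu.bdry']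

/-- The method of lower and upper solutions under a one-sided Nagumo condition. -/
theorem exists_solution_between {f : ℝ → ℝ → ℝ → ℝ} {α β : ℝ → ℝ} {Y C : ℝ}
    (hf : ContinuousOn (fun p : ℝ × ℝ × ℝ => f p.1 p.2.1 p.2.2) (Icc (0 : ℝ) 1 ×ˢ univ))
    (hα : IsLowerSolution f α) (hβ : IsUpperSolution f β)
    (hαβ : ∀ t ∈ Icc (0 : ℝ) 1, α t ≤ β t)
    (hr₁ : d1 α 1 ≤ d1 α 0) (hr₂ : d1 β 0 ≤ d1 β 1) (hY : 0 < Y) (hC : 0 ≤ C)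
    (hgrow : OneSidedGrowth (region α β) f Y C ∨
      OneSidedGrowth (region α β) (fun t x y => -f t x y) Y C) :
    ∃ x : ℝ → ℝ, IsSolution f x ∧ ∀ t ∈ Icc (0 : ℝ) 1, α t ≤ x t ∧ x t ≤ β t := by
  obtain ⟨A, hA⟩ := isCompact_Icc.exists_bound_of_continuousOn hα.contDiffOn.continuousOn
  obtain ⟨B, hB⟩ := isCompact_Icc.exists_bound_of_continuousOn hβ.contDiffOn.continuousOn
  obtain ⟨A', hA'⟩ := isCompact_Icc.exists_bound_of_continuousOn
    (contDiffOn_d1 hα.contDiffOn).continuousOn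
  obtain ⟨B', hB'⟩ := isCompact_Icc.exists_bound_of_continuousOn
    (contDiffOn_d1 hβ.contDiffOn).continuousOn
  simp only [Real.norm_eq_abs] at hA hB hA' hB'
  set R := max A B
  -- `N` dominates `|α'|` and `|β'|` (for the comparison), `Y` (so that truncation respects the
  -- growth range) and the Nagumo bound.
  set N := max (max A' B') (max Y (Y * Real.exp (C * (R - -R))))
  have hNY : Y ≤ N := (le_max_left _ _).trans (le_max_right _ _)
  have hNe : Y * Real.exp (C * (R - -R)) ≤ N := (le_max_right _ _).trans (le_max_right _ _)
  have hNA : A' ≤ N := (le_max_left _ _).trans (le_max_left _ _)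
  have hNB : B' ≤ N := (le_max_right _ _).trans (le_max_left _ _)
  have hαR : ∀ t ∈ Icc (0 : ℝ) 1, -R ≤ α t := fun t ht =>
    (abs_le.1 ((hA t ht).trans (le_max_left _ _))).1
  have hβR : ∀ t ∈ Icc (0 : ℝ) 1, β t ≤ R := fun t ht =>
    (abs_le.1 ((hB t ht).trans (le_max_right _ _))).2
  have m0 : (0 : ℝ) ∈ Icc (0 : ℝ) 1 := ⟨le_rfl, zero_le_one⟩
  have hR : -R ≤ R := (hαR 0 m0).trans ((hαβ 0 m0).trans (hβR 0 m0))
  have hN : -N ≤ N := by linarith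
  let τ : ℝ → ℝ := fun t => projIcc (0 : ℝ) 1 zero_le_one t
  have hτm : ∀ t, τ t ∈ Icc (0 : ℝ) 1 := fun t => (projIcc (0 : ℝ) 1 zero_le_one t).2
  have hτc : Continuous τ := continuous_subtype_val.comp continuous_projIcc
  have hτ : ∀ t ∈ Icc (0 : ℝ) 1, τ t = t := fun t ht => by
    simp only [τ, projIcc_of_mem zero_le_one ht]
  have hαc : Continuous fun t => α (τ t) := hα.contDiffOn.continuousOn.comp_continuous hτc hτm
  have hβc : Continuous fun t => β (τ t) := hβ.contDiffOn.continuousOn.comp_continuous hτc hτm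
  let P : ℝ → ℝ → ℝ := fun t x => max (α (τ t)) (min (β (τ t)) x)
  let Q : ℝ → ℝ := fun y => projIcc (-N) N hN y
  have hQ : ∀ y, Q y = max (-N) (min N y) := fun y => rfl
  have hQid : ∀ y, |y| ≤ N → Q y = y := fun y hy => by
    simp only [Q, projIcc_of_mem hN (abs_le.1 hy)]
  let g : ℝ × ℝ × ℝ → ℝ := fun p => f (τ p.1) (P p.1 p.2.1) (Q p.2.2) + P p.1 p.2.1
  have hPc : Continuous fun p : ℝ × ℝ × ℝ => P p.1 p.2.1 := by
    simp only [P]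
    exact (hαc.comp continuous_fst).max ((hβc.comp continuous_fst).min
      (continuous_fst.comp continuous_snd))
  have hQc : Continuous Q := continuous_subtype_val.comp continuous_projIcc
  have hgc : Continuous g := by
    refine Continuous.add ?_ hPc
    exact hf.comp_continuous (f := fun p : ℝ × ℝ × ℝ => (τ p.1, P p.1 p.2.1, Q p.2.2))
      ((hτc.comp continuous_fst).prodMk (hPc.prodMk
        (hQc.comp (continuous_snd.comp continuous_snd)))) (fun p => ⟨hτm _, mem_univ _⟩)
  obtain ⟨hgu, M, hM⟩ := uniformContinuous_of_comp_projIcc hgc hR hN (fun t x y => by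
    have h1 : τ (projIcc (0 : ℝ) 1 zero_le_one t : ℝ) = τ t := hτ _ (hτm t)
    have h2 : Q (projIcc (-N) N hN y : ℝ) = Q y := by simp only [Q, projIcc_val]
    have h3 : P (projIcc (0 : ℝ) 1 zero_le_one t : ℝ) (projIcc (-R) R hR x : ℝ) = P t x := by
      simp only [P, h1]
      exact max_min_projIcc hR (hαR _ (hτm t)) (hαβ _ (hτm t)) (hβR _ (hτm t))
    simp only [g, h1, h2, h3])
  obtain ⟨u, u', hu⟩ := exists_periodic_solution_of_bounded hgu hM
  -- Where `u < α` and `u' = α'`, the truncated equation gives `α'' - u'' ≥ α - u > 0`.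
  have hαu : ∀ t ∈ Icc (0 : ℝ) 1, α t - u t ≤ 0 := by
    refine nonpos_of_deriv₂_pos
      (fun t ht => (hasDerivWithinAt_d1 hα.contDiffOn ht).sub (hu.deriv₁ t ht))
      (fun t ht => (hasDerivWithinAt_d2 hα.contDiffOn ht).sub (hu.deriv₂ t ht))
      (by simp [hα.bdry, hu.bdry]) (by simpa [hu.bdry'] using hr₁) (fun t ht hpos hz => ?_)
    have hz' : u' t = d1 α t := (sub_eq_zero.1 hz).symm
    have hP : P t (u t) = α t := by
      simp only [P, hτ t ht]
      exact max_eq_left ((min_le_right _ _).trans (sub_pos.1 hpos).le)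
    have hQ' : Q (u' t) = d1 α t := by
      rw [hz']
      exact hQid _ ((hA' t ht).trans hNA)
    have := hα.le t ht
    simp only [g, hτ t ht, hP, hQ']
    linarith
  have hβu : ∀ t ∈ Icc (0 : ℝ) 1, u t - β t ≤ 0 := by
    refine nonpos_of_deriv₂_pos
      (fun t ht => (hu.deriv₁ t ht).sub (hasDerivWithinAt_d1 hβ.contDiffOn ht))
      (fun t ht => (hu.deriv₂ t ht).sub (hasDerivWithinAt_d2 hβ.contDiffOn ht))
      (by simp [hβ.bdry, hu.bdry]) (by simp only [hu.bdry']; linarith) (fun t ht hpos hz => ?_)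
    have hz' : u' t = d1 β t := sub_eq_zero.1 hz
    have hP : P t (u t) = β t := by
      simp only [P, hτ t ht]
      rw [min_eq_left (sub_pos.1 hpos).le, max_eq_right (hαβ t ht)]
    have hQ' : Q (u' t) = d1 β t := by
      rw [hz']
      exact hQid _ ((hB' t ht).trans hNB)
    have := hβ.ge t ht
    simp only [g, hτ t ht, hP, hQ']
    linarith
  have hbetween : ∀ t ∈ Icc (0 : ℝ) 1, α t ≤ u t ∧ u t ≤ β t := fun t ht =>
    ⟨sub_nonpos.1 (hαu t ht), sub_nonpos.1 (hβu t ht)⟩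
  have hu₁ : IsPeriodicC2 u u' (fun t => -f t (u t) (Q (u' t))) := hu.congr fun t ht => by
    have hP : P t (u t) = u t := by
      simp only [P, hτ t ht]
      rw [min_eq_right (hbetween t ht).2, max_eq_right (hbetween t ht).1]
    simp only [g, hτ t ht, hP]
    ring
  have huR : ∀ t ∈ Icc (0 : ℝ) 1, -R ≤ u t ∧ u t ≤ R := fun t ht =>
    ⟨(hαR t ht).trans (hbetween t ht).1, (hbetween t ht).2.trans (hβR t ht)⟩
  -- Truncation keeps `y` beyond `±Y` without increasing its size, so the growth bound holds with
  -- the same `C`, independently of `N`.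
  have hQY : ∀ y, Y ≤ y → Y ≤ Q y ∧ C * Q y ^ 2 ≤ C * y ^ 2 := fun y hy => by
    have h1 : Y ≤ Q y := by rw [hQ]; exact le_max_of_le_right (le_min hNY hy)
    have h2 : Q y ≤ y := by rw [hQ]; exact max_le (by linarith) (min_le_right _ _)
    exact ⟨h1, mul_le_mul_of_nonneg_left (pow_le_pow_left₀ (hY.le.trans h1) h2 2) hC⟩
  have hQY' : ∀ y, y ≤ -Y → Q y ≤ -Y ∧ C * Q y ^ 2 ≤ C * y ^ 2 := fun y hy => by
    have h1 : Q y ≤ -Y := by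
      rw [hQ]; exact max_le (by linarith) ((min_le_right _ _).trans hy)
    have h2 : y ≤ Q y := by rw [hQ]; exact le_max_of_le_right (le_min (by linarith) le_rfl)
    exact ⟨h1, mul_le_mul_of_nonneg_left (by nlinarith) hC⟩
  have hu' : ∀ t ∈ Icc (0 : ℝ) 1, |u' t| ≤ N := by
    intro t ht
    refine le_trans ?_ hNe
    rcases hgrow with H | H
    · refine hu₁.abs_deriv_le hC hY huR (fun s hs => ?_) t ht
      have h := H s (u s) ⟨hs, hbetween s hs⟩ (Q (u' s))
      refine ⟨fun hy => ?_, fun hy => ?_⟩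
      · obtain ⟨a, b⟩ := hQY _ hy
        linarith [h.1 a]
      · obtain ⟨a, b⟩ := hQY' _ hy
        linarith [h.2 a]
    · refine hu₁.abs_deriv_le_of_reflect hC hY huR (fun s hs => ?_) t ht
      have h := H s (u s) ⟨hs, hbetween s hs⟩ (Q (u' s))
      refine ⟨fun hy => ?_, fun hy => ?_⟩
      · obtain ⟨a, b⟩ := hQY _ hy
        linarith [h.1 a]
      · obtain ⟨a, b⟩ := hQY' _ hy
        linarith [h.2 a]
  exact ⟨u, (hu₁.congr fun t ht => by rw [hQid _ (hu' t ht)]).isSolution hf, hbetween⟩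

end PeriodicBVP

/-! ### The main theorem -/

theorem theorem4
    (f f₁ f₂ : ℝ → ℝ → ℝ → ℝ) (α β c : ℝ → ℝ) (c₀ : ℝ)
    (hf : ContinuousOn (fun p : ℝ × ℝ × ℝ => f p.1 p.2.1 p.2.2) (Icc (0 : ℝ) 1 ×ˢ univ))
    (hsum : ∀ t ∈ Icc (0 : ℝ) 1, ∀ x y : ℝ, f t x y = f₁ t x y + f₂ t x y)
    (hα : PeriodicBVP.IsLowerSolution f α)
    (hβ : PeriodicBVP.IsUpperSolution f β)
    (hαβ : ∀ t ∈ Icc (0 : ℝ) 1, α t ≤ β t)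
    (hr₁ : 0 ≤ PeriodicBVP.d1 α 0 - PeriodicBVP.d1 α 1)
    (hr₂ : 0 ≤ PeriodicBVP.d1 β 1 - PeriodicBVP.d1 β 0)
    (hlip : PeriodicBVP.LipschitzNear f α β)
    (hc : ContinuousOn c (Icc 0 1))
    (hc₀ : c₀ < 1)
    (hcle : ∀ t ∈ Icc (0 : ℝ) 1, c t * (β t - α t) ≤ c₀)
    (hcond :
      (PeriodicBVP.UniformLimsupLE (PeriodicBVP.region α β) f₁ c ∧
        ∀ t x : ℝ, (t, x) ∈ PeriodicBVP.region α β → Antitone (f₂ t x)) ∨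
      (PeriodicBVP.UniformLiminfGE (PeriodicBVP.region α β) f₁ (fun t => -c t) ∧
        ∀ t x : ℝ, (t, x) ∈ PeriodicBVP.region α β → Monotone (f₂ t x))) :
    ∃ x : ℝ → ℝ, PeriodicBVP.IsSolution f x ∧
      ∀ t ∈ Icc (0 : ℝ) 1, α t ≤ x t ∧ x t ≤ β t := by
  obtain ⟨A, hA⟩ := isCompact_Icc.exists_bound_of_continuousOn hα.contDiffOn.continuousOn
  obtain ⟨B, hB⟩ := isCompact_Icc.exists_bound_of_continuousOn hβ.contDiffOn.continuousOn
  obtain ⟨C₁, hC₁⟩ := isCompact_Icc.exists_bound_of_continuousOn hc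
  have hΓ : ∀ t x, (t, x) ∈ PeriodicBVP.region α β →
      t ∈ Icc (0 : ℝ) 1 ∧ x ∈ Icc (-max A B) (max A B) := fun t x h =>
    ⟨h.1, (abs_le.1 ((hA t h.1).trans (le_max_left A B))).1.trans h.2.1,
      h.2.2.trans (abs_le.1 ((hB t h.1).trans (le_max_right A B))).2⟩
  have hcC : ∀ t ∈ Icc (0 : ℝ) 1, c t ≤ C₁ := fun t ht => (le_abs_self _).trans (hC₁ t ht)
  rcases hcond with ⟨h₁, h₂⟩ | ⟨h₁, h₂⟩
  · obtain ⟨Y, hY, C, hC, hgrow⟩ := PeriodicBVP.exists_oneSidedGrowth hf hsum hΓ hcC h₁ h₂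
    exact PeriodicBVP.exists_solution_between hf hα hβ hαβ (sub_nonneg.1 hr₁) (sub_nonneg.1 hr₂)
      hY hC (Or.inl hgrow)
  -- Case 2 for `f` is case 1 for `-f`; only the growth bound is transferred, the boundary value
  -- problem remains that of `f`.
  · obtain ⟨Y, hY, C, hC, hgrow⟩ := PeriodicBVP.exists_oneSidedGrowth
      (f := fun t x y => -f t x y) (f₁ := fun t x y => -f₁ t x y) (f₂ := fun t x y => -f₂ t x y)
      hf.neg (fun t ht x y => by rw [hsum t ht]; ring) hΓ hcC
      (fun ε hε => by
        obtain ⟨Y, hY, h⟩ := h₁ ε hε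
        refine ⟨Y, hY, fun t x htx y hy => ?_⟩
        have := h t x htx y hy
        rw [mul_neg, neg_div]
        linarith)
      (fun t x htx => (h₂ t x htx).neg)
    exact PeriodicBVP.exists_solution_between hf hα hβ hαβ (sub_nonneg.1 hr₁) (sub_nonneg.1 hr₂)
      hY hC (Or.inr hgrow)
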